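/- Let $\alpha>-1$ and $t\in\mathbb{R}$, and let $w(x,t)=(1-x^2)^{\alpha}\mathrm{e}^{-tx^2}$ for $x\in[-1,1]$. There is a unique sequence of monic real polynomials $P_n(x)=P_n(x,t)$, $n=0,1,2,\ldots$, with $\deg P_n=n$ and $$\int_{-1}^{1}P_m(x)P_n(x)\,w(x,t)\,dx=0\qquad(m\neq n).$$ For $n\ge 2$ let $p(n)=p(n,t)$ denote the coefficient of $x^{n-2}$ in $P_n(x,t)$, and set $p(0,t)=p(1,t)=0$. Then for every integer $n\ge 1$, $$\big(n-2t\,p(n)+2t\,p(n+1)\big)^2+2\alpha\big(n-2t\,p(n)+2t\,p(n+1)\big)$$ $$-\big(2n-1+2\alpha-2t\,p(n-1)+2t\,p(n+1)\big)\Big[n+2p(n)+2t\big(p(n)-p(n+1)\big)\big(p(n-1)-p(n)-1\big)\Big]=0,$$ with the initial conditions $$p(1,t)=0,\qquad p(2,t)=-\frac{\Phi\left(\frac32,\frac52+\alpha;-t\right)}{(3+2\alpha)\,\Phi\left(\frac12,\frac32+\alpha;-t\right)},$$ where $\Phi(a,b;z)=\sum_{k=0}^{\infty}\frac{(a)_k}{(b)_k}\frac{z^k}{k!}$,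 with $(a)_0=1$ and $(a)_k=a(a+1)\cdots(a+k-1)$, is Kummer's confluent hypergeometric function. -/

import Mathlib

open Polynomial

noncomputable section

/-- The symmetric semi-classical Jacobi weight `w(x,t) = (1 - x^2)^α exp(-t x^2)`
(used on `[-1, 1]`). -/
def jacobiWeight (α t x : ℝ) : ℝ :=
  (1 - x ^ 2) ^ α * Real.exp (-t * x ^ 2)

/-- `P 0, P 1, P 2, …` is the sequence of monic polynomials, `P n` of degree `n`, orthogonal on
`[-1, 1]` with respect to the weight `jacobiWeight α t`. -/
structure IsMonicOrthogonal (α t : ℝ) (P : ℕ → ℝ[X]) : Prop where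
  monic : ∀ n, (P n).Monic
  natDegree_eq : ∀ n, (P n).natDegree = n
  orthogonal : ∀ m n, m ≠ n →
    ∫ x in (-1 : ℝ)..1, (P m).eval x * (P n).eval x * jacobiWeight α t x = 0

/-- The coefficient of `x^(n-2)` in `P n`; by convention it is `0` for `n = 0` and `n = 1`. -/
def subleadingCoeff (P : ℕ → ℝ[X]) (n : ℕ) : ℝ :=
  if 2 ≤ n then (P n).coeff (n - 2) else 0

/-- Kummer's confluent hypergeometric function `Φ(a, b; z) = ∑ (a)_k / (b)_k * z^k / k!`, for
`b ≠ 0, -1, -2, …` (the series then converges for every `z`). -/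
def kummerPhi (a b z : ℝ) : ℝ :=
  ∑' k : ℕ, (ascPochhammer ℝ k).eval a / (ascPochhammer ℝ k).eval b * (z ^ k / (k.factorial : ℝ))

end

/-!
Write `L q` for the integral of `q` against the weight `w` over `[-1, 1]`. It is a positive
definite, even linear functional on `ℝ[X]`, and integration by parts (`jacobiFunctional_pearson`) gives
`L ((1 - X²) q') = L (X (2 (1 + α) + 2 t (1 - X²)) q)`. The recurrence for the subleading
coefficients `p n` uses only these three properties of `L`.

Positive definiteness gives existence and uniqueness of the monic orthogonal polynomials, and
evenness makes the recurrence `X P n = P (n + 1) + β n P (n - 1)` with `β n = p n - p (n + 1)`.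
Evaluating both sides of the Pearson equation on `P n P (n - 1)`, the left by comparing
coefficients and the right by the recurrence, yields (`pearson_relation`)
`n + 2 p n = β n (2 n + 1 + 2 α + 2 t - 2 t (β (n + 1) + β n + β (n - 1)))`.

Put `R n = n - 2 t β n` and `B n = R n + R (n + 1) + 2 α`. The relation says that the square bracket
of the theorem equals `β n B n`, so the claim is `F n = 0` for
`F n = R n ^ 2 + 2 α R n - β n B n B (n - 1)`. The difference of two consecutive relations gives
`F (n + 1) = F n`, and `F 0 = 0` since `β 0 = 0` (`first_integral_eq_zero`).

Finally `p 2 = - L X² / L 1`. Expanding `exp (-t x²)` reduces these two moments to those for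
`t = 0`, whose ratios follow from the Pearson equation and are quotients of Pochhammer symbols; the sums are
Kummer functions (`jacobiFunctional_X_pow`).
-/

/-! ### Orthogonal polynomials of a positive definite functional -/

/-- `P` is the sequence of monic orthogonal polynomials of the linear functional `L`: `P n` is
monic of degree `n`, and `L (P m * P n) = 0` for `m ≠ n`. -/
structure IsMonicOrthogonalFor (L : ℝ[X] →ₗ[ℝ] ℝ) (P : ℕ → ℝ[X]) : Prop where
  monic : ∀ n, (P n).Monic
  natDegree_eq : ∀ n, (P n).natDegree = n
  orthogonal : ∀ m n, m ≠ n → L (P m * P n) = 0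

/-- Nondegeneracy of the form `(q, r) ↦ L (q * r)` on polynomials of degree `< n` lets one subtract
from `X ^ n` its orthogonal projection. -/
lemma exists_monic_forall_apply_mul_eq_zero {L : ℝ[X] →ₗ[ℝ] ℝ}
    (hpos : ∀ q, q ≠ 0 → 0 < L (q * q)) (n : ℕ) :
    ∃ p : ℝ[X], p.Monic ∧ p.natDegree = n ∧ ∀ r : ℝ[X], r.degree < n → L (p * r) = 0 := by
  let B : LinearMap.BilinForm ℝ (degreeLT ℝ n) :=
    ((LinearMap.mul ℝ ℝ[X]).compr₂ L).compl₁₂ (degreeLT ℝ n).subtype (degreeLT ℝ n).subtype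
  have hBdef : ∀ q r : degreeLT ℝ n, B q r = L (q * r) := fun _ _ => rfl
  have hB : B.Nondegenerate := by
    refine ⟨fun q hq => ?_, fun q hq => ?_⟩ <;>
    · by_contra h
      have h1 := hpos q (by simpa using h)
      rw [← hBdef, hq q] at h1
      exact lt_irrefl _ h1
  have : FiniteDimensional ℝ (degreeLT ℝ n) := Module.Finite.equiv (degreeLTEquiv ℝ n).symm
  let f : Module.Dual ℝ (degreeLT ℝ n) :=
    L ∘ₗ LinearMap.mulLeft ℝ (X ^ n) ∘ₗ (degreeLT ℝ n).subtype
  have hf : ∀ r : degreeLT ℝ n, f r = L (X ^ n * (r : ℝ[X])) := fun _ => rfl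
  let q := (B.toDual hB).symm f
  have hq : ∀ r : degreeLT ℝ n, L ((q : ℝ[X]) * r) = L (X ^ n * (r : ℝ[X])) := fun r => by
    rw [← hBdef, ← hf]
    exact LinearMap.BilinForm.apply_toDual_symm_apply f r
  have hdeg : (q : ℝ[X]).degree < n := mem_degreeLT.1 q.2
  refine ⟨X ^ n - (q : ℝ[X]), (monic_X_pow n).sub_of_left (by simpa using hdeg), ?_, fun r hr => ?_⟩
  · apply natDegree_eq_of_degree_eq_some
    rw [degree_sub_eq_left_of_degree_lt] <;> simp [hdeg]
  · have := hq ⟨r, mem_degreeLT.2 hr⟩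
    rw [sub_mul, map_sub, this, sub_self]

lemma coeff_comp_neg_X (q : ℝ[X]) (k : ℕ) : (q.comp (-X)).coeff k = (-1) ^ k * q.coeff k := by
  rw [show (-X : ℝ[X]) = C (-1) * X by simp, comp_C_mul_X_coeff, mul_comm]

lemma degree_sub_C_coeff_mul_lt {p q : ℝ[X]} {n : ℕ} (hp : p.Monic) (hn : p.natDegree = n)
    (hq : q.degree < (n + 1 : ℕ)) : (q - C (q.coeff n) * p).degree < n := by
  rw [degree_lt_iff_coeff_zero] at hq ⊢
  intro m hm
  rcases hm.eq_or_lt with rfl | hm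
  · have : p.coeff n = 1 := by rw [← hn]; exact hp.coeff_natDegree
    simp [this]
  · simp [hq m hm, coeff_eq_zero_of_natDegree_lt (hn.trans_lt hm)]

namespace IsMonicOrthogonalFor

variable {L : ℝ[X] →ₗ[ℝ] ℝ} {P Q : ℕ → ℝ[X]}

lemma coeff_self (h : IsMonicOrthogonalFor L P) (n : ℕ) : (P n).coeff n = 1 := by
  have := (h.monic n).coeff_natDegree
  rwa [h.natDegree_eq] at this

lemma coeff_eq_zero (h : IsMonicOrthogonalFor L P) {n k : ℕ} (hk : n < k) :
    (P n).coeff k = 0 :=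
  coeff_eq_zero_of_natDegree_lt ((h.natDegree_eq n).trans_lt hk)

lemma zero_eq_one (h : IsMonicOrthogonalFor L P) : P 0 = 1 :=
  (Monic.natDegree_eq_zero (h.monic 0)).1 (h.natDegree_eq 0)

lemma apply_mul_eq_zero (h : IsMonicOrthogonalFor L P) {n : ℕ} {q : ℝ[X]} (hq : q.degree < n) :
    L (P n * q) = 0 := by
  suffices H : ∀ k ≤ n, ∀ q : ℝ[X], q.degree < k → L (P n * q) = 0 from H n le_rfl q hq
  intro k
  induction k with
  | zero =>
    intro _ q hq
    have : q = 0 := by simpa [degree_lt_iff_coeff_zero, Polynomial.ext_iff] using hq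
    simp [this]
  | succ k ih =>
    intro hk q hq
    have h1 := ih (by lia) _ (degree_sub_C_coeff_mul_lt (h.monic k) (h.natDegree_eq k) hq)
    rw [mul_sub, map_sub, mul_left_comm, ← smul_eq_C_mul, map_smul,
      h.orthogonal n k (by lia)] at h1
    simpa using h1

/-- Against `P n`, a polynomial of degree at most `n` contributes only its top coefficient. -/
lemma apply_mul (h : IsMonicOrthogonalFor L P) {n : ℕ} {q : ℝ[X]} (hq : q.degree < (n + 1 : ℕ)) :
    L (P n * q) = q.coeff n * L (P n * P n) := by
  have h1 := h.apply_mul_eq_zero (degree_sub_C_coeff_mul_lt (h.monic n) (h.natDegree_eq n) hq)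
  rw [mul_sub, map_sub, mul_left_comm, ← smul_eq_C_mul, map_smul, smul_eq_mul] at h1
  linarith

lemma degree_sub_lt (h : IsMonicOrthogonalFor L P) {q : ℝ[X]} (n : ℕ) (hq : q.degree < (n + 1 : ℕ))
    (hqn : q.coeff n = 1) : (q - P n).degree < n := by
  simpa [hqn] using degree_sub_C_coeff_mul_lt (h.monic n) (h.natDegree_eq n) hq

lemma eq_of_orthogonal (h : IsMonicOrthogonalFor L P) (hpos : ∀ q, q ≠ 0 → 0 < L (q * q))
    {q : ℝ[X]} {n : ℕ} (hq : q.degree < (n + 1 : ℕ)) (hqn : q.coeff n = 1)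
    (hort : ∀ r : ℝ[X], r.degree < n → L (q * r) = 0) : q = P n := by
  have hd := h.degree_sub_lt n hq hqn
  by_contra hne
  have h1 := hpos _ (sub_ne_zero.2 hne)
  rw [sub_mul, map_sub, hort _ hd, h.apply_mul_eq_zero hd, sub_zero] at h1
  exact lt_irrefl _ h1

lemma degree_lt (h : IsMonicOrthogonalFor L P) (n : ℕ) : (P n).degree < (n + 1 : ℕ) :=
  degree_lt_iff_coeff_zero _ _ |>.2 fun _ hm => h.coeff_eq_zero hm

lemma unique (h : IsMonicOrthogonalFor L P) (h' : IsMonicOrthogonalFor L Q)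
    (hpos : ∀ q, q ≠ 0 → 0 < L (q * q)) : P = Q :=
  funext fun n => h'.eq_of_orthogonal hpos (h.degree_lt n) (h.coeff_self n)
    fun _ hr => h.apply_mul_eq_zero hr

lemma exists_of_pos (hpos : ∀ q, q ≠ 0 → 0 < L (q * q)) :
    ∃ P : ℕ → ℝ[X], IsMonicOrthogonalFor L P := by
  choose P hm hd ho using exists_monic_forall_apply_mul_eq_zero hpos
  have hlt : ∀ m n, m < n → L (P n * P m) = 0 := fun m n hmn =>
    ho n _ (by
      rw [degree_eq_natDegree (hm m).ne_zero, hd]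
      exact_mod_cast hmn)
  refine ⟨P, hm, hd, fun m n hmn => ?_⟩
  rcases hmn.lt_or_gt with hlt' | hlt'
  · rw [mul_comm]; exact hlt m n hlt'
  · exact hlt n m hlt'

/-! ### The three-term recurrence for an even functional -/

/-- Evenness of `L` forces `P n` to have the parity of `n`; only the vanishing of the second
coefficient is needed. -/
lemma coeff_pred_eq_zero (h : IsMonicOrthogonalFor L P) (hpos : ∀ q, q ≠ 0 → 0 < L (q * q))
    (heven : ∀ q, L (q.comp (-X)) = L q) (n : ℕ) : (P (n + 1)).coeff n = 0 := by
  have hc : ∀ k, (C ((-1 : ℝ) ^ (n + 1)) * (P (n + 1)).comp (-X)).coeff k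
      = (-1) ^ (n + 1) * ((-1) ^ k * (P (n + 1)).coeff k) := fun k => by
    rw [coeff_C_mul, coeff_comp_neg_X]
  have h1 : C ((-1 : ℝ) ^ (n + 1)) * (P (n + 1)).comp (-X) = P (n + 1) := by
    apply h.eq_of_orthogonal hpos
    · rw [degree_lt_iff_coeff_zero]
      intro m hm
      rw [hc, h.coeff_eq_zero (by lia)]; simp
    · rw [hc, h.coeff_self, mul_one, ← mul_pow]; simp
    · intro r hr
      have h2 : ((P (n + 1)) * r.comp (-X)).comp (-X) = (P (n + 1)).comp (-X) * r := by
        rw [mul_comp, comp_assoc]; simp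
      rw [mul_assoc, ← smul_eq_C_mul, map_smul, ← h2, heven, h.apply_mul_eq_zero, smul_zero]
      rw [degree_lt_iff_coeff_zero] at hr ⊢
      intro m hm
      rw [coeff_comp_neg_X, hr m hm, mul_zero]
  have h2 := hc n
  rw [h1, ← mul_assoc, ← pow_add, show n + 1 + n = 2 * n + 1 by ring, pow_succ, pow_mul] at h2
  norm_num at h2
  linarith

end IsMonicOrthogonalFor

lemma coeff_eq_subleadingCoeff (P : ℕ → ℝ[X]) (n : ℕ) :
    (P (n + 2)).coeff n = subleadingCoeff P (n + 2) := by
  simp [subleadingCoeff]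

/-- The coefficient `β n` in the recurrence `X * P n = P (n + 1) + β n * P (n - 1)`. -/
noncomputable def recurrenceCoeff (P : ℕ → ℝ[X]) (n : ℕ) : ℝ :=
  subleadingCoeff P n - subleadingCoeff P (n + 1)

lemma recurrenceCoeff_zero (P : ℕ → ℝ[X]) : recurrenceCoeff P 0 = 0 := by
  simp [recurrenceCoeff, subleadingCoeff]

namespace IsMonicOrthogonalFor

variable {L : ℝ[X] →ₗ[ℝ] ℝ} {P : ℕ → ℝ[X]}

lemma X_mul_zero (h : IsMonicOrthogonalFor L P) (hpos : ∀ q, q ≠ 0 → 0 < L (q * q))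
    (heven : ∀ q, L (q.comp (-X)) = L q) : X * P 0 = P 1 := by
  apply h.eq_of_orthogonal hpos
  · rw [h.zero_eq_one, mul_one, degree_X]; norm_num
  · simp [h.zero_eq_one]
  · intro r hr
    have hr0 : r.natDegree = 0 := by
      rw [natDegree_eq_zero_iff_degree_le_zero]
      exact Nat.WithBot.lt_one_iff_le_zero.1 hr
    have h1 := heven X
    rw [X_comp, map_neg] at h1
    rw [eq_C_of_natDegree_eq_zero hr0, h.zero_eq_one, mul_one, mul_comm, ← smul_eq_C_mul, map_smul,
      show L X = 0 by linarith, smul_zero]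

/-- The three-term recurrence: the difference `d` of the two sides has degree `< n`, as `β (n + 1)`
matches the coefficients of `X ^ n`, and it is orthogonal to all polynomials of degree `< n`. -/
lemma X_mul_succ (h : IsMonicOrthogonalFor L P) (hpos : ∀ q, q ≠ 0 → 0 < L (q * q))
    (heven : ∀ q, L (q.comp (-X)) = L q) (n : ℕ) :
    X * P (n + 1) = P (n + 2) + C (recurrenceCoeff P (n + 1)) * P n := by
  have hpar := h.coeff_pred_eq_zero hpos heven
  suffices H : X * P (n + 1) - C (recurrenceCoeff P (n + 1)) * P n = P (n + 2) by
    rw [← H]; ring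
  set d := X * P (n + 1) - C (recurrenceCoeff P (n + 1)) * P n - P (n + 2) with hd
  have hdeg : d.degree < n := by
    rw [degree_lt_iff_coeff_zero]
    intro m hm
    rcases m with _ | m
    · obtain rfl : n = 0 := by lia
      simp [hd, h.coeff_self, recurrenceCoeff, coeff_eq_subleadingCoeff P 0]
      simp [subleadingCoeff]
    · simp only [hd, coeff_sub, coeff_X_mul, coeff_C_mul]
      rcases hm.eq_or_lt with rfl | hm
      · simp [h.coeff_self, recurrenceCoeff, coeff_eq_subleadingCoeff]
      rcases (show n ≤ m by lia).eq_or_lt with rfl | hm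
      · simp [hpar, h.coeff_eq_zero]
      rcases (show n + 1 ≤ m by lia).eq_or_lt with rfl | hm
      · simp [h.coeff_self, h.coeff_eq_zero (show n < n + 1 + 1 by lia)]
      · rw [h.coeff_eq_zero (show n + 1 < m by lia), h.coeff_eq_zero (show n < m + 1 by lia),
          h.coeff_eq_zero (show n + 2 < m + 1 by lia)]
        simp
  -- `d` is orthogonal to all polynomials of degree `< n`, itself included
  have hdd : L (d * d) = 0 := by
    have e : d * d = P (n + 1) * (X * d) - recurrenceCoeff P (n + 1) • (P n * d)
        - P (n + 2) * d := by
      rw [smul_eq_C_mul]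
      nth_rw 1 [hd]
      ring
    have hXd : (X * d).degree < ((n + 1 : ℕ) : WithBot ℕ) := by
      rw [degree_lt_iff_coeff_zero] at hdeg ⊢
      intro m hm
      rcases m with _ | m
      · simp
      · rw [coeff_X_mul, hdeg m (by lia)]
    rw [e, map_sub, map_sub, map_smul, h.apply_mul_eq_zero hXd, h.apply_mul_eq_zero hdeg,
      h.apply_mul_eq_zero (hdeg.trans (by exact_mod_cast (show n < n + 2 by lia)))]
    simp
  by_contra hne
  exact (hpos d (sub_ne_zero.2 hne)).ne' hdd

lemma apply_X_mul_succ_mul (h : IsMonicOrthogonalFor L P) (n : ℕ) :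
    L (X * P (n + 1) * P n) = L (P (n + 1) * P (n + 1)) := by
  have hdeg : (X * P n).degree < ((n + 1 + 1 : ℕ) : WithBot ℕ) := by
    rw [degree_lt_iff_coeff_zero]
    rintro (_ | m) hm
    · simp
    · rw [coeff_X_mul, h.coeff_eq_zero (by lia)]
  rw [show X * P (n + 1) * P n = P (n + 1) * (X * P n) by ring, h.apply_mul hdeg, coeff_X_mul,
    h.coeff_self, one_mul]

lemma apply_sq_succ (h : IsMonicOrthogonalFor L P) (hpos : ∀ q, q ≠ 0 → 0 < L (q * q))
    (heven : ∀ q, L (q.comp (-X)) = L q) (n : ℕ) :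
    L (P (n + 1) * P (n + 1)) = recurrenceCoeff P (n + 1) * L (P n * P n) := by
  rw [← h.apply_X_mul_succ_mul, h.X_mul_succ hpos heven, add_mul, map_add,
    h.orthogonal _ _ (by lia), zero_add, mul_assoc, ← smul_eq_C_mul, map_smul, smul_eq_mul]

lemma apply_X_mul_sq (h : IsMonicOrthogonalFor L P) (hpos : ∀ q, q ≠ 0 → 0 < L (q * q))
    (heven : ∀ q, L (q.comp (-X)) = L q) (n : ℕ) :
    L ((X * P n) * (X * P n))
      = (recurrenceCoeff P (n + 1) + recurrenceCoeff P n) * L (P n * P n) := by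
  rcases n with _ | n
  · rw [h.X_mul_zero hpos heven, h.apply_sq_succ hpos heven, recurrenceCoeff_zero, add_zero]
  · have e : (X * P (n + 1)) * (X * P (n + 1)) = P (n + 2) * P (n + 2)
        + (2 * recurrenceCoeff P (n + 1)) • (P (n + 2) * P n)
        + (recurrenceCoeff P (n + 1) * recurrenceCoeff P (n + 1)) • (P n * P n) := by
      rw [h.X_mul_succ hpos heven]
      simp only [smul_eq_C_mul, map_mul, map_ofNat]
      ring
    rw [e, map_add, map_add, map_smul, map_smul, h.orthogonal (n + 2) n (by lia),
      h.apply_sq_succ hpos heven (n + 1), smul_zero, smul_eq_mul, mul_assoc,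
      ← h.apply_sq_succ hpos heven n]
    ring

/-- The one cubic moment in the Pearson relation, from
`X ^ 3 P (n + 1) P n = (X P (n + 1)) (X ^ 2 P n)` and one use of the recurrence. -/
lemma apply_X_cube (h : IsMonicOrthogonalFor L P) (hpos : ∀ q, q ≠ 0 → 0 < L (q * q))
    (heven : ∀ q, L (q.comp (-X)) = L q) (n : ℕ) :
    L (X ^ 3 * (P (n + 1) * P n)) = (recurrenceCoeff P (n + 2) + recurrenceCoeff P (n + 1)
      + recurrenceCoeff P n) * L (P (n + 1) * P (n + 1)) := by
  have hdeg : (X * (X * P n)).degree < ((n + 2 + 1 : ℕ) : WithBot ℕ) := by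
    rw [degree_lt_iff_coeff_zero]
    rintro (_ | _ | m) hm
    · simp
    · simp
    · rw [coeff_X_mul, coeff_X_mul, h.coeff_eq_zero (by lia)]
  have e : X ^ 3 * (P (n + 1) * P n) = P (n + 2) * (X * (X * P n))
      + recurrenceCoeff P (n + 1) • ((X * P n) * (X * P n)) := by
    rw [smul_eq_C_mul]
    linear_combination (X ^ 2 * P n) * h.X_mul_succ hpos heven n
  rw [e, map_add, map_smul, h.apply_mul hdeg, coeff_X_mul, coeff_X_mul, h.coeff_self,
    h.apply_X_mul_sq hpos heven, h.apply_sq_succ hpos heven (n + 1), smul_eq_mul,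
    h.apply_sq_succ hpos heven n]
  ring

/-! ### The recurrence relations from the Pearson equation -/

/-- The Pearson equation applied to `P (n + 1) * P n`. -/
lemma pearson_relation (h : IsMonicOrthogonalFor L P) (hpos : ∀ q, q ≠ 0 → 0 < L (q * q))
    (heven : ∀ q, L (q.comp (-X)) = L q) {α t : ℝ}
    (hpearson : ∀ q, L ((1 - X ^ 2) * derivative q)
      = L (X * (C (2 * (1 + α)) + C (2 * t) * (1 - X ^ 2)) * q)) (n : ℕ) :
    (n + 1 : ℝ) + 2 * subleadingCoeff P (n + 1) = recurrenceCoeff P (n + 1) *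
      (2 * n + 3 + 2 * α + 2 * t - 2 * t * (recurrenceCoeff P (n + 2) + recurrenceCoeff P (n + 1)
        + recurrenceCoeff P n)) := by
  have hpar := h.coeff_pred_eq_zero hpos heven
  have hn : L (P n * P n) ≠ 0 := (hpos _ (h.monic n).ne_zero).ne'
  -- the term with `derivative (P n)`: only its leading coefficient `-n` contributes
  have h1 : L (P (n + 1) * ((1 - X ^ 2) * derivative (P n)))
      = -n * L (P (n + 1) * P (n + 1)) := by
    have hc : ∀ k, ((1 - X ^ 2) * derivative (P n)).coeff (k + 1)
        = (P n).coeff (k + 2) * (k + 2) - k * (P n).coeff k := by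
      rintro (_ | k)
      · simp [sub_mul, sq, mul_assoc, coeff_X_mul, coeff_derivative]; left; ring
      · simp [sub_mul, sq, mul_assoc, coeff_X_mul, coeff_derivative]; ring
    rw [h.apply_mul, hc, h.coeff_self, h.coeff_eq_zero (by lia)]
    · ring
    · rw [degree_lt_iff_coeff_zero]
      rintro (_ | m) hm
      · lia
      · rw [hc, h.coeff_eq_zero (by lia), h.coeff_eq_zero (by lia)]; simp
  -- the term with `derivative (P (n + 1))`: adding a multiple of `P (n + 2)` brings the degree
  -- down to `n`
  have h2 : L (P n * ((1 - X ^ 2) * derivative (P (n + 1))))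
      = ((n + 1) + 2 * subleadingCoeff P (n + 1) - (n + 1) * recurrenceCoeff P (n + 1))
        * L (P n * P n) := by
    have hc : ∀ k, ((1 - X ^ 2) * derivative (P (n + 1)) + C (n + 1 : ℝ) * P (n + 2)).coeff (k + 1)
        = (P (n + 1)).coeff (k + 2) * (k + 2) - k * (P (n + 1)).coeff k
          + (n + 1) * (P (n + 2)).coeff (k + 1) := by
      rintro (_ | k)
      · simp [sub_mul, sq, mul_assoc, coeff_X_mul, coeff_derivative, -map_add]; left; ring
      · simp [sub_mul, sq, mul_assoc, coeff_X_mul, coeff_derivative, -map_add]; ring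
    have hdeg : ((1 - X ^ 2) * derivative (P (n + 1)) + C (n + 1 : ℝ) * P (n + 2)).degree
        < ((n + 1 : ℕ) : WithBot ℕ) := by
      rw [degree_lt_iff_coeff_zero]
      rintro (_ | m) hm
      · lia
      · rw [hc]
        rcases (show n ≤ m by lia).eq_or_lt with rfl | hm
        · rw [hpar, hpar, h.coeff_eq_zero (by lia)]; simp
        rcases (show n + 1 ≤ m by lia).eq_or_lt with rfl | hm
        · rw [h.coeff_self, h.coeff_self, h.coeff_eq_zero (by lia)]; push_cast; ring
        · rw [h.coeff_eq_zero (show n + 1 < m + 2 by lia),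
            h.coeff_eq_zero (show n + 1 < m by lia), h.coeff_eq_zero (show n + 2 < m + 1 by lia)]
          ring
    have h3 := h.apply_mul hdeg
    rw [mul_add, map_add, mul_left_comm (P n) (C _),
      ← smul_eq_C_mul (p := P n * P (n + 2)), map_smul, h.orthogonal n (n + 2) (by lia),
      smul_zero, add_zero] at h3
    rw [h3]
    congr 1
    rcases n with _ | n
    · simp [sub_mul, sq, mul_assoc, coeff_derivative, h.coeff_self, coeff_eq_subleadingCoeff P 0,
        recurrenceCoeff]
      simp [subleadingCoeff]
    · rw [hc, h.coeff_self, recurrenceCoeff, coeff_eq_subleadingCoeff, coeff_eq_subleadingCoeff]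
      push_cast
      ring
  have h4 := hpearson (P (n + 1) * P n)
  have e1 : (1 - X ^ 2) * derivative (P (n + 1) * P n)
      = P n * ((1 - X ^ 2) * derivative (P (n + 1)))
        + P (n + 1) * ((1 - X ^ 2) * derivative (P n)) := by
    rw [derivative_mul]; ring
  have e2 : X * (C (2 * (1 + α)) + C (2 * t) * (1 - X ^ 2)) * (P (n + 1) * P n)
      = (2 * (1 + α) + 2 * t) • (X * P (n + 1) * P n)
        - (2 * t) • (X ^ 3 * (P (n + 1) * P n)) := by
    simp only [smul_eq_C_mul, map_add]; ring
  rw [e1, e2, map_add, map_sub, map_smul, map_smul, h1, h2, h.apply_X_mul_succ_mul,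
    h.apply_X_cube hpos heven, h.apply_sq_succ hpos heven, smul_eq_mul, smul_eq_mul] at h4
  apply mul_right_cancel₀ hn
  linear_combination h4

end IsMonicOrthogonalFor

/-! ### The first integral -/

/-- The first integral: the second-order relation `hrel` for `β` makes
`R n ^ 2 + 2 α R n - β n B n B (n - 1)` independent of `n`, where `R n = n - 2 t β n` and
`B n = R n + R (n + 1) + 2 α`; it vanishes at `n = 0`. -/
lemma first_integral_eq_zero {α t : ℝ} {p β : ℕ → ℝ} (hβ : ∀ n, β n = p n - p (n + 1))
    (h0 : p 0 = 0) (hβ0 : β 0 = 0)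
    (hrel : ∀ n : ℕ, (n + 1 : ℝ) + 2 * p (n + 1) = β (n + 1) *
      (2 * n + 3 + 2 * α + 2 * t - 2 * t * (β (n + 2) + β (n + 1) + β n))) (n : ℕ) :
    (n + 1 - 2 * t * β (n + 1)) ^ 2 + 2 * α * (n + 1 - 2 * t * β (n + 1))
      = β (n + 1) * (2 * n + 3 + 2 * α - 2 * t * (β (n + 2) + β (n + 1)))
        * (2 * n + 1 + 2 * α - 2 * t * (β (n + 1) + β n)) := by
  induction n with
  | zero =>
    have h1 := hrel 0
    have h2 := hβ 0
    simp only [hβ0, h0, zero_add, Nat.cast_zero] at *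
    have h3 : p 1 = 0 := by linarith
    rw [h3] at h1
    linear_combination (1 + 2 * α - 2 * t * β 1) * h1
  | succ n ih =>
    have h1 := hrel n
    have h2 := hrel (n + 1)
    have h3 := hβ (n + 1)
    push_cast at *
    simp only [Nat.add_assoc, Nat.reduceAdd] at *
    -- the difference of the claims at `n + 1` and `n` has the factor `B (n + 1)`; the cofactor
    -- vanishes by the difference of two consecutive relations `hrel`
    linear_combination ih
      + (2 * n + 3 + 2 * α - 2 * t * (β (n + 2) + β (n + 1))) * (h2 - h1 - 2 * h3)

section Weight

open MeasureTheory Set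

/-! ### The moment functional of the weight -/

lemma intervalIntegrable_one_sub_sq_rpow {a : ℝ} (ha : -1 < a) :
    IntervalIntegrable (fun x : ℝ => (1 - x ^ 2) ^ a) volume (-1) 1 := by
  have h0 : IntervalIntegrable (fun x : ℝ => (1 - x ^ 2) ^ a) volume 0 1 := by
    have h1 : IntervalIntegrable (fun x : ℝ => (1 - x) ^ a) volume 0 1 := by
      have := (intervalIntegral.intervalIntegrable_rpow' (a := 0) (b := 1) ha).comp_sub_left 1
      simpa using this.symm
    have h2 : ContinuousOn (fun x : ℝ => (1 + x) ^ a) (uIcc 0 1) := by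
      apply ContinuousOn.rpow_const (by fun_prop)
      intro x hx
      rw [uIcc_of_le zero_le_one] at hx
      left; linarith [hx.1]
    refine (h1.mul_continuousOn h2).congr ?_
    intro x hx
    rw [uIoc_of_le zero_le_one] at hx
    simp only
    rw [← Real.mul_rpow (by linarith [hx.2]) (by linarith [hx.1])]
    congr 1; ring
  have h1 := ((IntervalIntegrable.iff_comp_neg enorm_ne_top).1 h0).symm
  simp only [neg_sq, neg_zero] at h1
  exact h1.trans h0

lemma intervalIntegrable_mul_jacobiWeight {α : ℝ} (hα : -1 < α) (t : ℝ) {f : ℝ → ℝ}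
    (hf : Continuous f) :
    IntervalIntegrable (fun x => f x * jacobiWeight α t x) volume (-1) 1 := by
  have hc : Continuous fun x => f x * Real.exp (-t * x ^ 2) := by fun_prop
  refine ((intervalIntegrable_one_sub_sq_rpow hα).mul_continuousOn hc.continuousOn).congr ?_
  intro x _
  simp only [jacobiWeight]
  ring

lemma jacobiWeight_pos (α t : ℝ) {x : ℝ} (hx : x ∈ Ioo (-1 : ℝ) 1) : 0 < jacobiWeight α t x := by
  have : 0 < 1 - x ^ 2 := by nlinarith [hx.1, hx.2]
  exact mul_pos (Real.rpow_pos_of_pos this _) (Real.exp_pos _)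

lemma jacobiWeight_neg (α t x : ℝ) : jacobiWeight α t (-x) = jacobiWeight α t x := by
  simp [jacobiWeight]

/-- The linear functional `q ↦ ∫ q w` over `[-1, 1]`, where `w = jacobiWeight α t`. The hypothesis
on `α` makes the weight integrable, hence the functional additive. -/
noncomputable def jacobiFunctional {α : ℝ} (hα : -1 < α) (t : ℝ) : ℝ[X] →ₗ[ℝ] ℝ where
  toFun q := ∫ x in (-1 : ℝ)..1, q.eval x * jacobiWeight α t x
  map_add' p q := by
    simp only [eval_add, add_mul]
    exact intervalIntegral.integral_add (intervalIntegrable_mul_jacobiWeight hα t p.continuous)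
      (intervalIntegrable_mul_jacobiWeight hα t q.continuous)
  map_smul' c q := by
    simp only [eval_smul, smul_eq_mul, mul_assoc, RingHom.id_apply]
    exact intervalIntegral.integral_const_mul _ _

lemma jacobiFunctional_apply {α : ℝ} (hα : -1 < α) (t : ℝ) (q : ℝ[X]) :
    jacobiFunctional hα t q = ∫ x in (-1 : ℝ)..1, q.eval x * jacobiWeight α t x := rfl

lemma jacobiFunctional_mul_self_pos {α : ℝ} (hα : -1 < α) (t : ℝ) (q : ℝ[X]) (hq : q ≠ 0) :
    0 < jacobiFunctional hα t (q * q) := by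
  have hae : ∀ᵐ x : ℝ, x ≠ 1 := by simp [ae_iff, measure_singleton]
  rw [jacobiFunctional_apply, intervalIntegral.integral_pos_iff_support_of_nonneg_ae' ?_
    (intervalIntegrable_mul_jacobiWeight hα t (q * q).continuous)]
  · refine ⟨by norm_num, ?_⟩
    have hfin : volume (q.roots.toFinset : Set ℝ) = 0 := Finset.measure_zero _ _
    have hsub : Ioo (-1 : ℝ) 1 \ q.roots.toFinset ⊆ Function.support
        (fun x => (q * q).eval x * jacobiWeight α t x) ∩ Ioc (-1) 1 := by
      rintro x ⟨hx, hxr⟩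
      refine ⟨?_, Ioo_subset_Ioc_self hx⟩
      have hx0 : q.eval x ≠ 0 := by simpa [hq] using hxr
      simp [hx0, (jacobiWeight_pos α t hx).ne']
    refine lt_of_lt_of_le ?_ (measure_mono hsub)
    rw [measure_sdiff_null hfin]
    simp
  · rw [uIoc_of_le (by norm_num)]
    refine (ae_restrict_iff' measurableSet_Ioc).2 ?_
    filter_upwards [hae] with x hx1 hx
    have := jacobiWeight_pos α t ⟨hx.1, lt_of_le_of_ne hx.2 hx1⟩
    simp only [Pi.zero_apply, eval_mul]
    exact mul_nonneg (mul_self_nonneg _) this.le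

lemma jacobiFunctional_comp_neg_X {α : ℝ} (hα : -1 < α) (t : ℝ) (q : ℝ[X]) :
    jacobiFunctional hα t (q.comp (-X)) = jacobiFunctional hα t q := by
  have := intervalIntegral.integral_comp_neg (a := -1) (b := 1)
    (fun x => q.eval x * jacobiWeight α t x)
  simpa [jacobiFunctional_apply, jacobiWeight_neg] using this

/-- The Pearson equation `((1 - x²) w)' = -x (2 (1 + α) + 2 t (1 - x²)) w` in weak form. The
boundary terms vanish because `α + 1 > 0`. -/
lemma jacobiFunctional_pearson {α : ℝ} (hα : -1 < α) (t : ℝ) (q : ℝ[X]) :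
    jacobiFunctional hα t ((1 - X ^ 2) * derivative q)
      = jacobiFunctional hα t (X * (C (2 * (1 + α)) + C (2 * t) * (1 - X ^ 2)) * q) := by
  rw [← sub_eq_zero, ← map_sub, jacobiFunctional_apply]
  have hne : α + 1 ≠ 0 := by linarith
  rw [intervalIntegral.integral_eq_sub_of_hasDerivAt_of_le (by norm_num)
    (f := fun x => (1 - x ^ 2) ^ (α + 1) * (Real.exp (-t * x ^ 2) * q.eval x)) ?_ ?_
    (intervalIntegrable_mul_jacobiWeight hα t (Polynomial.continuous _))]
  · simp [Real.zero_rpow hne]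
  · refine ContinuousOn.mul (ContinuousOn.rpow_const (by fun_prop) ?_) (by fun_prop)
    intro x _
    right; linarith
  · intro x hx
    have hpos : 0 < 1 - x ^ 2 := by nlinarith [hx.1, hx.2]
    have h1 : HasDerivAt (fun x : ℝ => 1 - x ^ 2) (-(2 * x)) x := by
      simpa using (hasDerivAt_pow 2 x).const_sub 1
    have h2 : HasDerivAt (fun x : ℝ => -t * x ^ 2) (-t * (2 * x)) x := by
      simpa using (hasDerivAt_pow 2 x).const_mul (-t)
    have h3 := (h1.rpow_const (p := α + 1) (Or.inl hpos.ne')).mul (h2.exp.mul (q.hasDerivAt x))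
    refine h3.congr_deriv ?_
    simp only [jacobiWeight, eval_sub, eval_mul, eval_one, eval_pow, eval_X, eval_add, eval_C,
      add_sub_cancel_right, Pi.mul_apply]
    rw [Real.rpow_add_one hpos.ne']
    ring

/-! ### Moments and Kummer's function -/

/-- The moments for `t = 0`, by integration by parts. -/
lemma jacobiFunctional_zero_X_pow_succ {α : ℝ} (hα : -1 < α) (k : ℕ) :
    jacobiFunctional hα 0 (X ^ (2 * (k + 1))) * (k + 3 / 2 + α)
      = jacobiFunctional hα 0 (X ^ (2 * k)) * (k + 1 / 2) := by
  have h := jacobiFunctional_pearson hα 0 (X ^ (2 * k + 1))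
  have e1 : (1 - X ^ 2) * derivative (X ^ (2 * k + 1) : ℝ[X])
      = (2 * k + 1 : ℝ) • (X ^ (2 * k) - X ^ (2 * (k + 1))) := by
    simp [smul_eq_C_mul]; ring
  have e2 : X * (C (2 * (1 + α)) + C (2 * 0) * (1 - X ^ 2)) * (X ^ (2 * k + 1) : ℝ[X])
      = (2 * (1 + α)) • X ^ (2 * (k + 1)) := by
    rw [mul_zero, C_0, smul_eq_C_mul]; ring
  rw [e1, e2, map_smul, map_smul, map_sub, smul_eq_mul, smul_eq_mul] at h
  linear_combination -h / 2

lemma jacobiFunctional_zero_X_pow_add {α : ℝ} (hα : -1 < α) (j k : ℕ) :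
    jacobiFunctional hα 0 (X ^ (2 * (j + k))) * (ascPochhammer ℝ k).eval (j + 3 / 2 + α)
      = jacobiFunctional hα 0 (X ^ (2 * j)) * (ascPochhammer ℝ k).eval (j + 1 / 2 : ℝ) := by
  induction k with
  | zero => simp
  | succ k ih =>
    have h := jacobiFunctional_zero_X_pow_succ hα (j + k)
    push_cast at h
    rw [ascPochhammer_succ_eval, ascPochhammer_succ_eval, ← add_assoc j k 1]
    linear_combination (ascPochhammer ℝ k).eval (j + 3 / 2 + α) * h + (j + 1 / 2 + k : ℝ) * ih

/-- Expanding `exp (-t x²)` and integrating term by term gives Kummer's function. -/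
lemma jacobiFunctional_X_pow {α : ℝ} (hα : -1 < α) (t : ℝ) (j : ℕ) :
    jacobiFunctional hα t (X ^ (2 * j))
      = jacobiFunctional hα 0 (X ^ (2 * j)) * kummerPhi (j + 1 / 2) (j + 3 / 2 + α) (-t) := by
  have hint := intervalIntegrable_one_sub_sq_rpow hα
  have hs : HasSum
      (fun k : ℕ => ∫ x in (-1 : ℝ)..1, (x ^ (2 * (j + k)) * jacobiWeight α 0 x)
        * ((-t) ^ k / (k.factorial : ℝ)))
      (∫ x in (-1 : ℝ)..1, x ^ (2 * j) * jacobiWeight α t x) := by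
    refine intervalIntegral.hasSum_integral_of_dominated_convergence
      (fun k x => (1 - x ^ 2) ^ α * (|t| ^ k / (k.factorial : ℝ))) ?_ ?_ ?_ ?_ ?_
    · intro k
      have := ((intervalIntegrable_mul_jacobiWeight hα 0
        (continuous_pow (2 * (j + k)))).mul_const ((-t) ^ k / (k.factorial : ℝ)))
      exact (intervalIntegrable_iff.1 this).aestronglyMeasurable
    · intro k
      refine Filter.Eventually.of_forall fun x hx => ?_
      rw [uIoc_of_le (by norm_num)] at hx
      have hx2 : 0 ≤ 1 - x ^ 2 := by nlinarith [hx.1, hx.2]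
      have hw : 0 ≤ (1 - x ^ 2) ^ α := Real.rpow_nonneg hx2 _
      have hxp : |x| ^ (2 * (j + k)) ≤ 1 := pow_le_one₀ (abs_nonneg _) (abs_le.2 ⟨hx.1.le, hx.2⟩)
      have hw' : jacobiWeight α 0 x = (1 - x ^ 2) ^ α := by simp [jacobiWeight]
      rw [hw', Real.norm_eq_abs, abs_mul, abs_mul, abs_div, abs_pow, abs_pow, abs_neg,
        abs_of_nonneg hw, Nat.abs_cast]
      gcongr
      exact mul_le_of_le_one_left hw hxp
    · exact Filter.Eventually.of_forall fun x _ =>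
        (Real.summable_pow_div_factorial |t|).mul_left _
    · simp only [tsum_mul_left]
      exact hint.mul_const _
    · refine Filter.Eventually.of_forall fun x _ => ?_
      have h1 : HasSum (fun k : ℕ => (-t * x ^ 2) ^ k / (k.factorial : ℝ))
          (Real.exp (-t * x ^ 2)) := by
        rw [Real.exp_eq_exp_ℝ]
        exact NormedSpace.expSeries_div_hasSum_exp _
      have h2 := (h1.mul_left ((1 - x ^ 2) ^ α)).mul_left (x ^ (2 * j))
      refine (congrArg (HasSum · _) (funext fun k => ?_)).mpr h2
      simp only [jacobiWeight, neg_zero, zero_mul, Real.exp_zero, mul_one]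
      rw [mul_pow, ← pow_mul, mul_add 2 j k, pow_add]
      ring
  have hterm : ∀ k : ℕ, (∫ x in (-1 : ℝ)..1, (x ^ (2 * (j + k)) * jacobiWeight α 0 x)
        * ((-t) ^ k / (k.factorial : ℝ)))
      = jacobiFunctional hα 0 (X ^ (2 * j)) * ((ascPochhammer ℝ k).eval (j + 1 / 2 : ℝ)
        / (ascPochhammer ℝ k).eval (j + 3 / 2 + α) * ((-t) ^ k / (k.factorial : ℝ))) := by
    intro k
    have hb : (ascPochhammer ℝ k).eval (j + 3 / 2 + α) ≠ 0 :=
      (ascPochhammer_pos k _ (by linarith [(Nat.cast_nonneg j : (0 : ℝ) ≤ j)])).ne'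
    have h := jacobiFunctional_zero_X_pow_add hα j k
    rw [← eq_div_iff hb, jacobiFunctional_apply] at h
    simp only [eval_pow, eval_X] at h
    rw [intervalIntegral.integral_mul_const, h]
    ring
  simp only [hterm] at hs
  rw [kummerPhi, ← tsum_mul_left, hs.tsum_eq, jacobiFunctional_apply]
  simp

end Weight

/-! ### The value of `p 2` and the recurrence for `p` -/

lemma isMonicOrthogonal_iff {α : ℝ} (hα : -1 < α) (t : ℝ) (P : ℕ → ℝ[X]) :
    IsMonicOrthogonal α t P ↔ IsMonicOrthogonalFor (jacobiFunctional hα t) P := by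
  constructor
  · rintro ⟨h1, h2, h3⟩
    exact ⟨h1, h2, fun m n hmn => by simpa [jacobiFunctional_apply] using h3 m n hmn⟩
  · rintro ⟨h1, h2, h3⟩
    exact ⟨h1, h2, fun m n hmn => by simpa [jacobiFunctional_apply] using h3 m n hmn⟩

/-- Orthogonality of `P 2 = X ^ 2 + p 2` to `1` expresses `p 2` as a quotient of moments. -/
lemma subleadingCoeff_two {α t : ℝ} (hα : -1 < α) {P : ℕ → ℝ[X]}
    (h : IsMonicOrthogonalFor (jacobiFunctional hα t) P) :
    subleadingCoeff P 2 = -(kummerPhi (3 / 2) (5 / 2 + α) (-t)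
      / ((3 + 2 * α) * kummerPhi (1 / 2) (3 / 2 + α) (-t))) := by
  have hpos := jacobiFunctional_mul_self_pos hα t
  have hpar := h.coeff_pred_eq_zero hpos (jacobiFunctional_comp_neg_X hα t) 1
  have hP : P 2 = X ^ 2 + C (subleadingCoeff P 2) * 1 := by
    rw [(P 2).as_sum_range_C_mul_X_pow, h.natDegree_eq]
    simp [Finset.sum_range_succ, hpar, h.coeff_self, subleadingCoeff]
    ring
  have h1 := h.orthogonal 2 0 (by lia)
  rw [h.zero_eq_one, mul_one, hP, ← smul_eq_C_mul, map_add, map_smul, smul_eq_mul] at h1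
  have m0 := jacobiFunctional_X_pow hα t 0
  have m1 := jacobiFunctional_X_pow hα t 1
  have m := jacobiFunctional_zero_X_pow_succ hα 0
  have hp0 := hpos 1 one_ne_zero
  have hz0 := jacobiFunctional_mul_self_pos hα 0 1 one_ne_zero
  norm_num at m0 m1 m hp0 hz0
  rw [m0] at h1 hp0
  rw [m1] at h1
  have hΦ : kummerPhi (1 / 2) (3 / 2 + α) (-t) ≠ 0 := right_ne_zero_of_mul hp0.ne'
  have hα' : 3 + 2 * α ≠ 0 := by linarith
  rw [← neg_div, eq_div_iff (mul_ne_zero hα' hΦ)]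
  apply mul_left_cancel₀ hz0.ne'
  linear_combination (3 + 2 * α) * h1 - 2 * kummerPhi (3 / 2) (5 / 2 + α) (-t) * m

theorem mainTheorem8 (α t : ℝ) (hα : -1 < α) :
    (∃! P : ℕ → ℝ[X], IsMonicOrthogonal α t P) ∧
    ∀ P : ℕ → ℝ[X], IsMonicOrthogonal α t P →
      ∀ p : ℕ → ℝ, p = subleadingCoeff P →
        (∀ n : ℕ, 1 ≤ n →
          ((n : ℝ) - 2 * t * p n + 2 * t * p (n + 1)) ^ 2
            + 2 * α * ((n : ℝ) - 2 * t * p n + 2 * t * p (n + 1))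
            - (2 * (n : ℝ) - 1 + 2 * α - 2 * t * p (n - 1) + 2 * t * p (n + 1))
              * ((n : ℝ) + 2 * p n
                  + 2 * t * (p n - p (n + 1)) * (p (n - 1) - p n - 1)) = 0) ∧
        p 1 = 0 ∧
        p 2 = -(kummerPhi (3 / 2) (5 / 2 + α) (-t)
                / ((3 + 2 * α) * kummerPhi (1 / 2) (3 / 2 + α) (-t))) := by
  have hpos := jacobiFunctional_mul_self_pos hα t
  refine ⟨?_, ?_⟩
  · obtain ⟨P, hP⟩ := IsMonicOrthogonalFor.exists_of_pos hpos
    exact ⟨P, (isMonicOrthogonal_iff hα t P).2 hP,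
      fun Q hQ => ((isMonicOrthogonal_iff hα t Q).1 hQ).unique hP hpos⟩
  · rintro P hP p rfl
    have h := (isMonicOrthogonal_iff hα t P).1 hP
    refine ⟨?_, by simp [subleadingCoeff], subleadingCoeff_two hα h⟩
    intro n hn
    obtain ⟨n, rfl⟩ := Nat.exists_eq_add_of_le' hn
    have hrel := h.pearson_relation hpos (jacobiFunctional_comp_neg_X hα t)
      (jacobiFunctional_pearson hα t)
    have hfirst := first_integral_eq_zero (fun _ => rfl) (by simp [subleadingCoeff])
      (recurrenceCoeff_zero P) hrel n
    have h1 := hrel n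
    rw [Nat.add_sub_cancel]
    simp only [recurrenceCoeff, Nat.add_assoc, Nat.reduceAdd] at hfirst h1 ⊢
    push_cast
    -- the Pearson relation turns the last bracket into `β (n + 1) * B (n + 1)`
    linear_combination hfirst - (2 * (n : ℝ) + 1 + 2 * α - 2 * t * subleadingCoeff P n
      + 2 * t * subleadingCoeff P (n + 2)) * h1
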